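/- **Setting.** Let $\mathcal G$ be a finite DAG on variables $\mathbf X^{(1)}=\{X_1^{(1)},\dots,X_k^{(1)}\}$ (potentially missing), $\mathbf O=\{O_1,\dots,O_m\}$ (always observed), $\mathbf R=\{R_1,\dots,R_k\}$ (missingness indicators) and $\mathbf X=\{X_1,\dots,X_k\}$ (observed proxies), such that $\mathrm{pa}_{\mathcal G}(X_i)=\{R_i,X_i^{(1)}\}$ and no $R_i$ has a descendant in $\mathbf X^{(1)}\cup\mathbf O$. Every vertex counts as an ancestor and as a descendant of itself. The proxy is $X_i=X_i^{(1)}$ if $R_i=1$ and $X_i=\text{“?”}$ if $R_i=0$. The *missing data model* of $\mathcal G$ (for given $\sigma$-finite reference measures on the state spaces of the variables in $\mathbf X^{(1)}\cup\mathbf O$, and counting measure for the indicators) is the set of distributions of $(\mathbf X^{(1)},\mathbf O,\mathbf R)$ with density $\prod_{V\in\mathbf X^{(1)}\cup\mathbf O\cup\mathbf R}p(V\mid\mathrm{pa}_{\mathcal G}(V))$ and with $p(R_i=1\mid\mathrm{pa}_{\mathcal G}(R_i))>0$ almost surely for each $i$. The *target law* is $p(\mathbf X^{(1)},\mathbf O)$;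 it is *identified* if on this model it is a function of the observed data law $p(\mathbf R,\mathbf O,\mathbf X)$. **Fixing schedules.** In a conditional mixed graph, let $D_Z$ be the district of a set $Z$ of random vertices, $\mathrm{mb}(Z)=(D_Z\cup\mathrm{pa}(D_Z))\setminus Z$ and $\mathbf R_Z=\{R_j: X_j^{(1)}\in Z\cup\mathrm{mb}(Z),\ R_j\notin Z\}$. Given a set $\mathbf S$ of selected variables, a set $Z$ inside a single district is *fixable* if (i) $\mathrm{de}(Z)\cap D_Z\subseteq Z$, (ii) $\mathbf S\cap Z=\emptyset$, and (iii) $Z$ is m-separated from $(\mathbf S\cup\mathbf R_Z)\setminus\mathrm{mb}(Z)$ given $\mathrm{mb}(Z)$; a set that spans several districts is fixable if it can be partitioned into fixable sets, each inside a single district. A *fixing schedule* is a partial order $\lhd$ on a partition of a subset of $\mathbf X^{(1)}\cup\mathbf R\cup\mathbf O$. For a member $\widetilde Z$ of the partition and a set $\mathbf X^{(1)}_{\widetilde Z}\subseteq\mathbf X^{(1)}$ treated as observed at its stage, the graph $\phi_{\lhd_{\widetilde Z}}(\mathcal G)$ is obtained from $\mathcal G$ by fixing all variables in members strictly earlier than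 $\widetilde Z$ (removing all edges with arrowheads into them), projecting out the remaining variables of $\mathbf X^{(1)}\setminus\mathbf X^{(1)}_{\widetilde Z}$ as hidden, and marking as selected every indicator that lies in $\mathbf R_{Y}$, computed in $\phi_{\lhd_{Y}}(\mathcal G)$, for some earlier member $Y$ and has not been fixed. The schedule is *valid* in $\mathcal G$ if every member $\widetilde Z$ is fixable in $\phi_{\lhd_{\widetilde Z}}(\mathcal G)$ (required inductively along $\lhd$). **Lemma.** Suppose that for every $R_i\in\mathbf R$, $$\{R_j: X_j^{(1)}\in\mathrm{pa}_{\mathcal G}(R_i)\}\cap\mathrm{an}_{\mathcal G}(R_i)=\emptyset .$$ Then for every $R_i\in\mathbf R$ the following fixing schedule is valid in $\mathcal G$: its partition is $\{\{R_j\}: R_j\in\mathbf R\cap\mathrm{de}_{\mathcal G}(R_i)\}$, the set $\{R_j\}$ comes before $\{R_k\}$ when $R_k$ is an ancestor of $R_j$ in $\mathcal G$ (so that $\{R_i\}$ comes last), and $\mathbf X^{(1)}_{\widetilde Z}=\mathbf X^{(1)}$ for every member $\widetilde Z$. Moreover, the target law $p(\mathbf X^{(1)},\mathbf O)$ is identified.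 -/

import Mathlib

open MeasureTheory Relation
open scoped ENNReal

namespace MissingData

noncomputable section

/-! ## Mixed graphs -/

/-- Vertices, directed edges `a → b` and bidirected edges `a ↔ b` of a conditional mixed graph
`G(V, W)`: `random` is `V`, `fixed` is `W`. -/
structure MixedGraph (V : Type*) where
  random : Set V
  fixed : Set V
  dir : V → V → Prop
  bi : V → V → Prop

namespace MixedGraph

variable {V : Type*} (G : MixedGraph V)

/-- Parents of a set. -/
def pa (A : Set V) : Set V := {u | ∃ a ∈ A, G.dir u a}

/-- Descendants of a set; every vertex is a descendant of itself. -/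
def de (A : Set V) : Set V := {u | ∃ a ∈ A, ReflTransGen G.dir a u}

/-- Ancestors of a set; every vertex is an ancestor of itself. -/
def an (A : Set V) : Set V := {u | ∃ a ∈ A, ReflTransGen G.dir u a}

/-- The union of the districts of the elements of a set: everything that can be reached from it
along bidirected edges. -/
def dis (A : Set V) : Set V := {u | ∃ a ∈ A, ReflTransGen G.bi a u}

/-- `A` lies inside a single district of `G`. -/
def InOneDistrict (A : Set V) : Prop := ∃ d ∈ G.random, A ⊆ G.dis {d}

/-- The Markov blanket `(D_A ∪ pa(D_A)) \ A` of a set `A`, where `D_A` is its district. -/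
def mb (A : Set V) : Set V := (G.dis A ∪ G.pa (G.dis A)) \ A

/-- The three ways of traversing an edge from a vertex `a` to a vertex `b`:
`a → b`, `a ← b`, `a ↔ b`. -/
inductive EdgeKind
  | right
  | left
  | both

/-- `G` has an edge of the given kind between `a` and `b`. As usual for m-separation in conditional
mixed graphs, any two different fixed vertices count as joined by a bidirected edge (no
independence among fixed variables is asserted). -/
def Step : EdgeKind → V → V → Prop
  | .right, a, b => G.dir a b
  | .left, a, b => G.dir b a
  | .both, a, b => G.bi a b ∨ (a ∈ G.fixed ∧ b ∈ G.fixed ∧ a ≠ b)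

/-- An arrowhead at the end of the edge. -/
def EdgeKind.headAtEnd : EdgeKind → Prop
  | .right => True
  | .left => False
  | .both => True

/-- An arrowhead at the beginning of the edge. -/
def EdgeKind.headAtStart : EdgeKind → Prop
  | .right => False
  | .left => True
  | .both => True

/-- There is a path `p 0, …, p n` without repeated vertices from `a` to `b` that is m-connecting
given `C`: every collider on it is an ancestor of `C` and no non-collider on it lies in `C`. -/
def MConnected (a b : V) (C : Set V) : Prop :=
  ∃ (n : ℕ) (p : ℕ → V) (e : ℕ → EdgeKind),
    p 0 = a ∧ p n = b ∧ Set.InjOn p (Set.Iic n) ∧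
    (∀ k < n, G.Step (e k) (p k) (p (k + 1))) ∧
    ∀ k, k + 1 < n →
      (((e k).headAtEnd ∧ (e (k + 1)).headAtStart) → p (k + 1) ∈ G.an C) ∧
      (¬ ((e k).headAtEnd ∧ (e (k + 1)).headAtStart) → p (k + 1) ∉ C)

/-- m-separation of `A` and `B` given `C`. -/
def MSep (A B C : Set V) : Prop := ∀ a ∈ A, ∀ b ∈ B, ¬ G.MConnected a b C

/-- Fixing the vertices of `A` in a graph: they become fixed, and all edges with arrowheads into
`A` are removed. -/
def fix (A : Set V) : MixedGraph V where
  random := G.random \ A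
  fixed := G.fixed ∪ A
  dir a b := G.dir a b ∧ b ∉ A
  bi a b := G.bi a b ∧ a ∉ A ∧ b ∉ A

/-- There is a directed path (with at least one edge) from `a` to `b` all of whose intermediate
vertices lie in `H`. -/
def DirVia (H : Set V) (a b : V) : Prop :=
  ∃ c, ReflTransGen (fun x y => G.dir x y ∧ y ∈ H) a c ∧ G.dir c b

/-- Latent projection of a (conditional) directed acyclic graph `G` onto the vertices outside the
hidden set `H`. A collider-free path `a ← ⋯ → b` with intermediate vertices in `H` consists of
directed paths to `a` and to `b` through `H` from a common hidden vertex `h`. -/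
def latentProj (H : Set V) : MixedGraph V where
  random := G.random \ H
  fixed := G.fixed \ H
  dir a b := a ∉ H ∧ b ∉ H ∧ G.DirVia H a b
  bi a b := a ∉ H ∧ b ∉ H ∧ a ≠ b ∧ ∃ h ∈ H, G.DirVia H h a ∧ G.DirVia H h b

end MixedGraph

/-! ## Missing data DAGs -/

/-- The vertices of a missing data DAG: the potentially missing variables `X_i^(1)` (`full i`),
the always observed variables `O_j` (`obs j`), the missingness indicators `R_i` (`ind i`) and the
observed proxies `X_i` (`proxy i`). -/
inductive Vertex (ι κ : Type*)
  | full (i : ι)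
  | obs (j : κ)
  | ind (i : ι)
  | proxy (i : ι)

/-- A missing data DAG. -/
structure MissingDAG (ι κ : Type*) where
  /-- `edge u v` means `u → v`. -/
  edge : Vertex ι κ → Vertex ι κ → Prop
  acyclic : ∀ v, ¬ TransGen edge v v
  pa_proxy : ∀ i u, edge u (.proxy i) ↔ u = .ind i ∨ u = .full i
  de_ind_full : ∀ i k, ¬ ReflTransGen edge (.ind i) (.full k)
  de_ind_obs : ∀ i j, ¬ ReflTransGen edge (.ind i) (.obs j)

/-- The set `X^(1)` of all potentially missing variables. -/
def allFull (ι κ : Type*) : Set (Vertex ι κ) := Set.range Vertex.full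

/-- A fixing schedule: a set of variables among `X^(1)`, `O`, `R`, partitioned into the sets in
`classes`, with a partial order `le` on the partition. Earlier sets are fixed first. -/
structure FixingSchedule (ι κ : Type*) where
  classes : Set (Set (Vertex ι κ))
  nonempty : ∀ A ∈ classes, A.Nonempty
  disjoint : classes.PairwiseDisjoint id
  not_proxy : ∀ A ∈ classes, ∀ i, Vertex.proxy i ∉ A
  le : Set (Vertex ι κ) → Set (Vertex ι κ) → Prop
  le_refl : ∀ A ∈ classes, le A A
  le_antisymm : ∀ A ∈ classes, ∀ B ∈ classes, le A B → le B A → A = B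
  le_trans : ∀ A ∈ classes, ∀ B ∈ classes, ∀ C ∈ classes, le A B → le B C → le A C

namespace FixingSchedule

variable {ι κ : Type*} (F : FixingSchedule ι κ)

/-- The members of the partition that are strictly earlier than `A`. -/
def before (A : Set (Vertex ι κ)) : Set (Set (Vertex ι κ)) :=
  {B | B ∈ F.classes ∧ F.le B A ∧ B ≠ A}

/-- The largest elements of the set of strictly earlier members. -/
def maxBefore (A : Set (Vertex ι κ)) : Set (Set (Vertex ι κ)) :=
  {B | B ∈ F.before A ∧ ∀ C ∈ F.before A, F.le B C → C = B}

end FixingSchedule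

/-- A subproblem: a conditional mixed graph, with some of the `X^(1)` marked as observed and some
variables marked as selected. -/
structure Subproblem (ι κ : Type*) where
  graph : MixedGraph (Vertex ι κ)
  observed : Set (Vertex ι κ)
  selected : Set (Vertex ι κ)

/-- `R_A = {R_j | X_j^(1) ∈ A ∪ mb(A), R_j ∉ A}`. -/
def indOf {ι κ : Type*} (G : MixedGraph (Vertex ι κ)) (A : Set (Vertex ι κ)) :
    Set (Vertex ι κ) :=
  {v | ∃ j, v = .ind j ∧ Vertex.full j ∈ A ∪ G.mb A ∧ Vertex.ind j ∉ A}

namespace Subproblem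

variable {ι κ : Type*} (P : Subproblem ι κ)

/-- Fixability of a set that lies in a single district. -/
def FixableInDistrict (A : Set (Vertex ι κ)) : Prop :=
  P.graph.InOneDistrict A ∧
  P.graph.de A ∩ P.graph.dis A ⊆ A ∧
  P.selected ∩ A = ∅ ∧
  P.graph.MSep A ((P.selected ∪ indOf P.graph A) \ P.graph.mb A) (P.graph.mb A)

/-- Fixability of a set. A set that spans several districts is fixable if it can be partitioned
into fixable sets each of which lies in a single district. -/
def Fixable (A : Set (Vertex ι κ)) : Prop :=
  P.FixableInDistrict A ∨
  (¬ P.graph.InOneDistrict A ∧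
    ∃ Q : Set (Set (Vertex ι κ)), Q.PairwiseDisjoint id ∧ ⋃₀ Q = A ∧
      ∀ B ∈ Q, B.Nonempty ∧ P.FixableInDistrict B)

end Subproblem

namespace MissingDAG

variable {ι κ : Type*} (G : MissingDAG ι κ)

/-- `G` as a mixed graph without fixed vertices and without bidirected edges. -/
def toMixed : MixedGraph (Vertex ι κ) where
  random := Set.univ
  fixed := ∅
  dir := G.edge
  bi _ _ := False

/-- The graph in which the member `A` of the schedule `F` is to be fixed, where `X1 A ⊆ X^(1)` is
the set that is treated as observed at that stage: all earlier members are fixed and the rest of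
`X^(1)` is hidden (unless it has been fixed). -/
def graphAt (F : FixingSchedule ι κ) (X1 : Set (Vertex ι κ) → Set (Vertex ι κ))
    (A : Set (Vertex ι κ)) : MixedGraph (Vertex ι κ) :=
  (G.toMixed.fix (⋃₀ F.before A)).latentProj ((allFull ι κ \ X1 A) \ ⋃₀ F.before A)

/-- The subproblem in which the member `A` of the schedule `F` is to be fixed. Whenever an earlier
member `B` has been fixed, the `X_j^(1)` in `B` or in its Markov blanket become observed, and the
indicators in `R_B` become selected, unless they have been fixed. -/
def problemAt (F : FixingSchedule ι κ) (X1 : Set (Vertex ι κ) → Set (Vertex ι κ))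
    (A : Set (Vertex ι κ)) : Subproblem ι κ where
  graph := G.graphAt F X1 A
  observed := {v | v ∈ allFull ι κ ∧ ∃ B ∈ F.before A, v ∈ B ∪ (G.graphAt F X1 B).mb B}
  selected := {v | ∃ B ∈ F.before A, v ∈ indOf (G.graphAt F X1 B) B} \ ⋃₀ F.before A

/-- Validity of the restriction of the schedule to the members up to and including `A`. -/
inductive ValidUpTo (F : FixingSchedule ι κ) (X1 : Set (Vertex ι κ) → Set (Vertex ι κ)) :
    Set (Vertex ι κ) → Prop
  | intro (A : Set (Vertex ι κ)) (hA : A ∈ F.classes)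
      (hbefore : ∀ B ∈ F.maxBefore A, ValidUpTo F X1 B)
      (hfix : (G.problemAt F X1 A).Fixable A) : ValidUpTo F X1 A

/-- A fixing schedule is valid in `G` if it is valid up to each of its members. -/
def Valid (F : FixingSchedule ι κ) (X1 : Set (Vertex ι κ) → Set (Vertex ι κ)) : Prop :=
  ∀ A ∈ F.classes, G.ValidUpTo F X1 A

/-- Two vertices that are ancestors of each other agree. -/
theorem eq_of_anc {u v : Vertex ι κ} (h : ReflTransGen G.edge u v)
    (h' : ReflTransGen G.edge v u) : u = v := by
  rcases reflTransGen_iff_eq_or_transGen.1 h with h1 | h1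
  · exact h1.symm
  · exact absurd (h1.trans_left h') (G.acyclic u)

/-- The schedule that fixes the singletons `{R_j}`, `R_j` a descendant of `R_i` (possibly `R_i`
itself), where `{R_j}` is earlier than `{R_k}` if `R_k` is an ancestor of `R_j`. -/
def ancestralSchedule (i : ι) : FixingSchedule ι κ where
  classes := {A | ∃ j, ReflTransGen G.edge (.ind i) (.ind j) ∧ A = {Vertex.ind j}}
  nonempty := by
    rintro A ⟨j, -, rfl⟩
    exact Set.singleton_nonempty _
  disjoint := by
    rintro A ⟨j, -, rfl⟩ B ⟨k, -, rfl⟩ h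
    exact Set.disjoint_singleton.2 fun h' => h (by rw [h'])
  not_proxy := by
    rintro A ⟨j, -, rfl⟩ k h
    simp at h
  le A B := ∃ j k, A = {Vertex.ind j} ∧ B = {Vertex.ind k} ∧
    ReflTransGen G.edge (.ind k) (.ind j)
  le_refl := by
    rintro A ⟨j, -, rfl⟩
    exact ⟨j, j, rfl, rfl, .refl⟩
  le_antisymm := by
    rintro A - B - ⟨j, k, rfl, rfl, h⟩ ⟨k', j', hk, hj, h'⟩
    rw [Set.singleton_eq_singleton_iff] at hk hj
    rw [← hk, ← hj] at h'
    rw [G.eq_of_anc h h']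
  le_trans := by
    rintro A - B - C - ⟨j, k, rfl, rfl, h⟩ ⟨k', l, hk, rfl, h'⟩
    rw [Set.singleton_eq_singleton_iff] at hk
    rw [← hk] at h'
    exact ⟨j, l, rfl, rfl, h'.trans h⟩

end MissingDAG

/-! ## Missing data models and identification -/

section Model

variable {ι κ : Type*} {S : ι → Type*} {T : κ → Type*}

/-- Values `(x^(1), o, r)` of the variables in `X^(1)`, `O`, `R`; `true` is the value 1 of an
indicator. -/
abbrev Config (S : ι → Type*) (T : κ → Type*) := (∀ i, S i) × (∀ j, T j) × (ι → Bool)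

/-- The value of the proxy `X_i`: it is `x_i^(1)` if `r_i = 1` and "?" (`Sum.inr ()`) if
`r_i = 0`. -/
def proxyValue (c : Config S T) (i : ι) : S i ⊕ Unit :=
  if c.2.2 i = true then Sum.inl (c.1 i) else Sum.inr ()

/-- Two configurations give the same value to the variable at the vertex `v`. -/
def SameAt (c c' : Config S T) : Vertex ι κ → Prop
  | .full i => c.1 i = c'.1 i
  | .obs j => c.2.1 j = c'.2.1 j
  | .ind i => c.2.2 i = c'.2.2 i
  | .proxy i => proxyValue c i = proxyValue c' i

/-- The function `f` depends only on the variable at `v` and on the parents of `v`. -/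
def MissingDAG.IsLocalAt (G : MissingDAG ι κ) (v : Vertex ι κ) (f : Config S T → ℝ≥0∞) : Prop :=
  ∀ c c' : Config S T, SameAt c c' v → (∀ u, G.edge u v → SameAt c c' u) → f c = f c'

open Classical in
/-- Replace the value of `X_i^(1)`. -/
def Config.setFull (c : Config S T) (i : ι) (s : S i) : Config S T :=
  (Function.update c.1 i s, c.2.1, c.2.2)

open Classical in
/-- Replace the value of `O_j`. -/
def Config.setObs (c : Config S T) (j : κ) (t : T j) : Config S T :=
  (c.1, Function.update c.2.1 j t, c.2.2)

open Classical in
/-- Replace the value of `R_i`. -/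
def Config.setInd (c : Config S T) (i : ι) (b : Bool) : Config S T :=
  (c.1, c.2.1, Function.update c.2.2 i b)

variable [∀ i, MeasurableSpace (S i)] [∀ j, MeasurableSpace (T j)]

/-- The target law `p(X^(1), O)`. -/
def targetLaw (P : Measure (Config S T)) : Measure ((∀ i, S i) × (∀ j, T j)) :=
  P.map fun c => (c.1, c.2.1)

/-- The observed values `(r, o, x)` that belong to a configuration. -/
def observe (c : Config S T) : (ι → Bool) × (∀ j, T j) × (∀ i, S i ⊕ Unit) :=
  (c.2.2, c.2.1, proxyValue c)

theorem measurable_observe :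
    Measurable (observe : Config S T → (ι → Bool) × (∀ j, T j) × (∀ i, S i ⊕ Unit)) := by
  refine Measurable.prodMk (by fun_prop) (Measurable.prodMk (by fun_prop) ?_)
  refine measurable_pi_lambda _ fun i => ?_
  refine Measurable.ite ?_ (measurable_inl.comp (by fun_prop)) measurable_const
  exact (show Measurable fun c : Config S T => c.2.2 i by fun_prop) (measurableSet_singleton true)

/-- The observed data law `p(R, O, X)`. -/
def observedLaw (P : Measure (Config S T)) :
    Measure ((ι → Bool) × (∀ j, T j) × (∀ i, S i ⊕ Unit)) :=
  P.map observe

variable [Fintype ι] [Fintype κ]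

/-- The full law `P` of `X^(1), O, R` belongs to the missing data model of `G`: with respect to
the product of the reference measures `μ i` (for `X_i^(1)`), `ν j` (for `O_j`) and counting
measures (for the indicators) it has a density that is the product of conditional densities
`p(V | pa(V))` over the vertices `V` in `X^(1) ∪ O ∪ R`; and `p(R_i = 1 | pa(R_i)) > 0` almost
surely, for each `i`. -/
def MissingDAG.InModel (G : MissingDAG ι κ) (μ : ∀ i, Measure (S i)) (ν : ∀ j, Measure (T j))
    (P : Measure (Config S T)) : Prop :=
  IsProbabilityMeasure P ∧
  ∃ (f : ι → Config S T → ℝ≥0∞) (g : κ → Config S T → ℝ≥0∞) (h : ι → Config S T → ℝ≥0∞),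
    (∀ i, Measurable (f i) ∧ G.IsLocalAt (.full i) (f i) ∧
      ∀ c : Config S T, ∫⁻ s, f i (c.setFull i s) ∂(μ i) = 1) ∧
    (∀ j, Measurable (g j) ∧ G.IsLocalAt (.obs j) (g j) ∧
      ∀ c : Config S T, ∫⁻ t, g j (c.setObs j t) ∂(ν j) = 1) ∧
    (∀ i, Measurable (h i) ∧ G.IsLocalAt (.ind i) (h i) ∧
      ∀ c : Config S T, h i (c.setInd i true) + h i (c.setInd i false) = 1) ∧
    P = ((Measure.pi μ).prod ((Measure.pi ν).prod Measure.count)).withDensity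
      (fun c => (∏ i, f i c) * (∏ j, g j c) * ∏ i, h i c) ∧
    ∀ i, ∀ᵐ c ∂P, 0 < h i (c.setInd i true)

/-- The target law is identified in the missing data model of `G`: it is a function of the observed
data law. -/
def MissingDAG.TargetIdentified (G : MissingDAG ι κ) (μ : ∀ i, Measure (S i))
    (ν : ∀ j, Measure (T j)) : Prop :=
  ∃ Φ : Measure ((ι → Bool) × (∀ j, T j) × (∀ i, S i ⊕ Unit)) →
      Measure ((∀ i, S i) × (∀ j, T j)),
    ∀ P, G.InModel μ ν P → targetLaw P = Φ (observedLaw P)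

end Model

end

end MissingData

/-! Validity. No variable is hidden at any stage, and only strict descendants of R_j are fixed
before R_j. So districts are singletons, the Markov blanket of R_j is pa_G(R_j), and the only
children left to R_j are proxies whose own outgoing edges have been cut. The m-separation is then a
local Markov property (`mSep_ancestralGraph`). The hypothesis is what keeps R_j unselected: an
earlier R_k could select it only if X_j^(1) → R_k, with R_j an ancestor of R_k.

Identification. Write z = (x^(1), o) and let a(z) ∏ h_i(z, r) be the density of the full law. Each
h_i sees r only through ancestors of R_i. By the hypothesis, if r_j = 1 for all non-ancestors R_j of
R_i, then h_i and all h_k with R_k a descendant of R_i are functions of the observed values. Two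
laws with the same observed law are compared, and their h_i are shown to agree by induction from
descendants to ancestors (`ae_h_eq`). Dividing the density by the h_k of the strict descendants
leaves q_i h_i, where q_i = `predDens` is the density of X^(1), O and the non-descendants of R_i.
Integrals of q_i h_i against functions of the observed values are thus identified. Summing over r_i
identifies those of q_i, provided that x_i^(1) does not enter. Since h_i does not involve x_i^(1)
either, comparing the two determines h_i where q_i ≠ 0.

Finally a is the density of the complete cases r = 1 divided by ∏ h_i (`ae_a_eq`). Positivity is
only assumed almost surely under the full law; `prod_propensity_ne_zero` turns it into what these
divisions need. -/

namespace MissingData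

namespace MissingDAG

/-! ### The ancestor order on the indicators -/

variable {ι κ : Type*} (G : MissingDAG ι κ)

/-- The indicator `R_l` is an ancestor of `R_i` (possibly `R_i` itself). -/
def IndAnc (l i : ι) : Prop := ReflTransGen G.edge (.ind l) (.ind i)

variable {G}

theorem IndAnc.refl (i : ι) : G.IndAnc i i := ReflTransGen.refl

theorem IndAnc.trans {i j k : ι} (h : G.IndAnc i j) (h' : G.IndAnc j k) : G.IndAnc i k :=
  ReflTransGen.trans h h'

theorem IndAnc.antisymm {i j : ι} (h : G.IndAnc i j) (h' : G.IndAnc j i) : i = j := by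
  simpa using G.eq_of_anc h h'

theorem indAnc_of_edge {l i : ι} (h : G.edge (.ind l) (.ind i)) : G.IndAnc l i :=
  ReflTransGen.single h

theorem indAnc_of_proxy_edge {l i : ι} (h : G.edge (.proxy l) (.ind i)) : G.IndAnc l i :=
  ReflTransGen.trans (.single ((G.pa_proxy l (.ind l)).2 (.inl rfl))) (.single h)

theorem ne_of_edge_ind {l i : ι} (h : G.edge (.ind l) (.ind i)) : l ≠ i := by
  rintro rfl
  exact G.acyclic _ (.single h)

theorem ne_of_proxy_edge {l i : ι} (h : G.edge (.proxy l) (.ind i)) : l ≠ i := by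
  rintro rfl
  exact G.acyclic _ (.tail (.single h) ((G.pa_proxy l (.ind l)).2 (.inl rfl)))

/-- Strict descendants count as smaller, so induction along this relation treats them before R_i, as
the schedule does. -/
theorem wellFounded_strictDesc [Finite ι] (G : MissingDAG ι κ) :
    WellFounded fun k i : ι => G.IndAnc i k ∧ k ≠ i :=
  haveI : IsTrans ι fun k i : ι => G.IndAnc i k ∧ k ≠ i :=
    ⟨fun _ _ _ h h' => ⟨h'.1.trans h.1, fun e => h.2 (h.1.antisymm (e ▸ h'.1) ▸ rfl)⟩⟩
  haveI : Std.Irrefl fun k i : ι => G.IndAnc i k ∧ k ≠ i := ⟨fun _ h => h.2 rfl⟩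
  Finite.wellFounded_of_trans_of_irrefl _

theorem wellFounded_strictAnc [Finite ι] (G : MissingDAG ι κ) :
    WellFounded fun k i : ι => G.IndAnc k i ∧ k ≠ i :=
  haveI : IsTrans ι fun k i : ι => G.IndAnc k i ∧ k ≠ i :=
    ⟨fun _ _ _ h h' => ⟨h.1.trans h'.1, fun e => h.2 (h.1.antisymm (e ▸ h'.1))⟩⟩
  haveI : Std.Irrefl fun k i : ι => G.IndAnc k i ∧ k ≠ i := ⟨fun _ h => h.2 rfl⟩
  Finite.wellFounded_of_trans_of_irrefl _

/-! ### Validity of the ancestral schedule -/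

theorem mem_before_ancestralSchedule {i j : ι} (hij : G.IndAnc i j) (B : Set (Vertex ι κ)) :
    B ∈ (G.ancestralSchedule i).before {.ind j} ↔
      ∃ k, B = {.ind k} ∧ G.IndAnc j k ∧ k ≠ j := by
  constructor
  · rintro ⟨-, ⟨k, l, rfl, hl, h⟩, hne⟩
    obtain rfl : j = l := by simpa using hl
    exact ⟨k, rfl, h, fun e => hne (by rw [e])⟩
  · rintro ⟨k, rfl, h, hne⟩
    exact ⟨⟨k, hij.trans h, rfl⟩, ⟨k, j, rfl, rfl, h⟩, by simpa using hne⟩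

theorem mem_sUnion_before_ancestralSchedule {i j : ι} (hij : G.IndAnc i j) (v : Vertex ι κ) :
    v ∈ ⋃₀ (G.ancestralSchedule i).before {.ind j} ↔
      ∃ k, v = .ind k ∧ G.IndAnc j k ∧ k ≠ j := by
  simp only [Set.mem_sUnion, mem_before_ancestralSchedule hij]
  constructor
  · rintro ⟨_, ⟨k, rfl, h⟩, rfl⟩
    exact ⟨k, rfl, h⟩
  · rintro ⟨k, rfl, h⟩
    exact ⟨_, ⟨k, rfl, h⟩, rfl⟩

variable (G) in
/-- The stage of the ancestral schedule of `R_i` at which `R_j` is fixed. -/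
def ancestralGraph (i j : ι) : MixedGraph (Vertex ι κ) :=
  G.graphAt (G.ancestralSchedule i) (fun _ => allFull ι κ) {.ind j}

/-- With an empty hidden set the projection changes nothing; only the edges into fixed vertices, the
strict descendants of R_j, are lost. -/
theorem ancestralGraph_dir {i j : ι} (hij : G.IndAnc i j) (u v : Vertex ι κ) :
    (G.ancestralGraph i j).dir u v ↔ G.edge u v ∧ ∀ k, v = .ind k → G.IndAnc j k → k = j := by
  have h := mem_sUnion_before_ancestralSchedule hij v
  have hv : (∀ k, v = .ind k → G.IndAnc j k → k = j) ↔
      v ∉ ⋃₀ (G.ancestralSchedule i).before {.ind j} := by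
    rw [h]; grind
  rw [hv]
  simp only [ancestralGraph, graphAt, MixedGraph.latentProj, MixedGraph.DirVia, MixedGraph.fix,
    toMixed, Set.sdiff_self, Set.empty_sdiff, Set.mem_empty_iff_false, not_false_eq_true, true_and, and_false]
  constructor
  · rintro ⟨c, hc, h⟩
    rcases ReflTransGen.cases_tail hc with rfl | ⟨_, _, h'⟩
    exacts [h, h'.elim]
  · exact fun h => ⟨u, .refl, h⟩

theorem ancestralGraph_bi (i j : ι) (u v : Vertex ι κ) : ¬ (G.ancestralGraph i j).bi u v := by
  simp [ancestralGraph, graphAt, MixedGraph.latentProj]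

theorem ancestralGraph_fixed {i j : ι} (hij : G.IndAnc i j) (v : Vertex ι κ) :
    v ∈ (G.ancestralGraph i j).fixed ↔ ∃ k, v = .ind k ∧ G.IndAnc j k ∧ k ≠ j := by
  rw [← mem_sUnion_before_ancestralSchedule hij v]
  simp [ancestralGraph, graphAt, MixedGraph.latentProj, MixedGraph.fix, toMixed]

theorem ancestralGraph_dis (i j : ι) (A : Set (Vertex ι κ)) :
    (G.ancestralGraph i j).dis A = A := by
  ext v
  constructor
  · rintro ⟨a, ha, h⟩
    rcases ReflTransGen.cases_tail h with rfl | ⟨_, _, h'⟩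
    exacts [ha, (ancestralGraph_bi _ _ _ _ h').elim]
  · exact fun h => ⟨v, h, .refl⟩

theorem ancestralGraph_mb {i j : ι} (hij : G.IndAnc i j) :
    (G.ancestralGraph i j).mb {.ind j} = {u | G.edge u (.ind j)} := by
  ext u
  simp only [MixedGraph.mb, ancestralGraph_dis, MixedGraph.pa, Set.mem_sdiff, Set.mem_union,
    Set.mem_singleton_iff, Set.mem_ofPred_eq, exists_eq_left, ancestralGraph_dir hij]
  constructor
  · rintro ⟨h | h, hne⟩
    exacts [absurd h hne, h.1]
  · refine fun h => ⟨.inr ⟨h, fun k hk _ => ?_⟩, ?_⟩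
    · simpa using hk.symm
    · rintro rfl
      exact G.acyclic _ (.single h)

theorem mem_indOf_ancestralGraph {i j : ι} (hij : G.IndAnc i j) (v : Vertex ι κ) :
    v ∈ indOf (G.ancestralGraph i j) {.ind j} ↔
      ∃ l, v = .ind l ∧ G.edge (.full l) (.ind j) ∧ l ≠ j := by
  simp [indOf, ancestralGraph_mb hij]

/-- A connecting path is stopped within its first two edges: either at a parent of R_j, which is a
conditioned non-collider, or at a proxy child of R_j. -/
theorem mSep_ancestralGraph {i j : ι} (hij : G.IndAnc i j) (B : Set (Vertex ι κ))
    (hB : ∀ v ∈ B, ∃ l, v = .ind l ∧ l ≠ j) :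
    (G.ancestralGraph i j).MSep {.ind j} (B \ (G.ancestralGraph i j).mb {.ind j})
      ((G.ancestralGraph i j).mb {.ind j}) := by
  rintro _ rfl b ⟨hb, hbC⟩ ⟨n, p, e, hp0, hpn, -, hstep, hcol⟩
  obtain ⟨l, rfl, hlj⟩ := hB b hb
  rw [ancestralGraph_mb hij] at hbC hcol
  rcases n with _ | n
  · rw [hp0] at hpn
    exact hlj (by simpa using hpn.symm)
  have h0 := hstep 0 (by omega)
  rw [hp0, zero_add] at h0
  have hnfix : Vertex.ind j ∉ (G.ancestralGraph i j).fixed := by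
    rw [ancestralGraph_fixed hij]
    rintro ⟨k, hk, -, hne⟩
    exact hne (by simpa using hk.symm)
  cases he : e 0 with
  | both =>
    rw [he] at h0
    rcases h0 with h0 | h0
    exacts [ancestralGraph_bi _ _ _ _ h0, hnfix h0.1]
  | left =>
    rw [he] at h0
    have h1 : G.edge (p 1) (.ind j) := ((ancestralGraph_dir hij _ _).1 h0).1
    rcases n with _ | n
    · rw [zero_add] at hpn
      exact hbC (hpn ▸ h1)
    · refine (hcol 0 (by omega)).2 ?_ h1
      rw [he]
      exact fun h => h.1
  | right =>
    rw [he] at h0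
    obtain ⟨h1, h2⟩ := (ancestralGraph_dir hij _ _).1 h0
    -- Indicator children of R_j are strict descendants, so the edges into them have been removed.
    obtain ⟨m, hm⟩ : ∃ m, p 1 = .proxy m := by
      cases hv : p 1 with
      | full k => exact absurd (.single (hv ▸ h1)) (G.de_ind_full j k)
      | obs k => exact absurd (.single (hv ▸ h1)) (G.de_ind_obs j k)
      | proxy m => exact ⟨m, rfl⟩
      | ind k =>
        rw [hv] at h1
        exact absurd (h2 k hv (indAnc_of_edge h1)) (ne_of_edge_ind h1).symm
    rw [hm] at h1
    rcases n with _ | n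
    · rw [zero_add] at hpn
      simp [hm] at hpn
    obtain ⟨hc1, -⟩ := hcol 0 (by omega)
    have hs := hstep 1 (by omega)
    rw [hm] at hs
    -- An open collider would be an ancestor of a parent of R_j while being a child of R_j, which
    -- closes a directed cycle.
    have hcollider (h : (e 1).headAtStart) : False := by
      obtain ⟨a, ha, hpa⟩ := hc1 ⟨by rw [he]; trivial, h⟩
      rw [zero_add, hm] at hpa
      have : ReflTransGen G.edge (.proxy m) a :=
        hpa.lift id fun u v h => ((ancestralGraph_dir hij _ _).1 h).1
      exact G.acyclic _ ((TransGen.head' h1 this).tail ha)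
    cases he1 : e 1 with
    | left => exact hcollider (by rw [he1]; trivial)
    | both => exact hcollider (by rw [he1]; trivial)
    | right =>
      rw [he1] at hs
      obtain ⟨h3, h4⟩ := (ancestralGraph_dir hij _ _).1 hs
      have h13 : ReflTransGen G.edge (.ind j) (p (1 + 1)) := .tail (.single h1) h3
      cases hv : p (1 + 1) with
      | full k => exact G.de_ind_full j k (hv ▸ h13)
      | obs k => exact G.de_ind_obs j k (hv ▸ h13)
      | proxy k => simp [hv, G.pa_proxy] at h3
      | ind k =>
        rw [hv] at h13 h3
        obtain rfl := h4 k hv h13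
        exact G.acyclic _ (.tail (.single h1) h3)

theorem fixable_ancestralSchedule
    (hG : ∀ i j : ι, G.edge (.full j) (.ind i) → ¬ ReflTransGen G.edge (.ind j) (.ind i))
    {i j : ι} (hij : G.IndAnc i j) :
    (G.problemAt (G.ancestralSchedule i) (fun _ => allFull ι κ) {.ind j}).Fixable {.ind j} := by
  have hsel : ∀ v ∈ (G.problemAt (G.ancestralSchedule i) (fun _ => allFull ι κ)
      {.ind j}).selected, ∃ l, v = .ind l ∧ l ≠ j := by
    rintro v ⟨⟨B, hB, hv⟩, -⟩
    obtain ⟨k, rfl, hjk, -⟩ := (mem_before_ancestralSchedule hij B).1 hB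
    obtain ⟨l, rfl, hl, -⟩ := (mem_indOf_ancestralGraph (hij.trans hjk) v).1 hv
    -- If R_j itself were selected, X_j^(1) would be a parent of its descendant R_k, against `hG`.
    refine ⟨l, rfl, ?_⟩
    rintro rfl
    exact hG _ _ hl hjk
  have hgr : (G.problemAt (G.ancestralSchedule i) (fun _ => allFull ι κ) {.ind j}).graph =
    G.ancestralGraph i j := rfl
  refine .inl ⟨⟨.ind j, ?_, ?_⟩, ?_, ?_, ?_⟩
  · have h := mem_sUnion_before_ancestralSchedule hij (.ind j)
    simp [problemAt, graphAt, MixedGraph.latentProj, MixedGraph.fix, toMixed] at h ⊢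
    exact h
  · rw [hgr, ancestralGraph_dis]
  · rw [hgr, ancestralGraph_dis]
    exact Set.inter_subset_right
  · ext v
    simp only [Set.mem_inter_iff, Set.mem_singleton_iff, Set.mem_empty_iff_false, iff_false]
    rintro ⟨hv, rfl⟩
    obtain ⟨l, hl, hne⟩ := hsel _ hv
    exact hne (by simpa using hl.symm)
  · rw [hgr]
    refine mSep_ancestralGraph hij _ ?_
    rintro v (hv | hv)
    · exact hsel v hv
    · obtain ⟨l, hl, -, hne⟩ := (mem_indOf_ancestralGraph hij v).1 hv
      exact ⟨l, hl, hne⟩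

theorem valid_ancestralSchedule [Finite ι]
    (hG : ∀ i j : ι, G.edge (.full j) (.ind i) → ¬ ReflTransGen G.edge (.ind j) (.ind i))
    (i : ι) : G.Valid (G.ancestralSchedule i) (fun _ => allFull ι κ) := by
  rintro _ ⟨j, hij, rfl⟩
  induction j using G.wellFounded_strictDesc.induction with
  | _ j ih =>
    refine .intro _ ⟨j, hij, rfl⟩ ?_ (fixable_ancestralSchedule hG hij)
    rintro B ⟨hB, -⟩
    obtain ⟨k, rfl, hjk, hne⟩ := (mem_before_ancestralSchedule hij B).1 hB
    exact ih k ⟨hjk, hne⟩ (hij.trans hjk)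

end MissingDAG

end MissingData

namespace MissingData

/-! ### Sums and positivity of products of propensities -/

section Propensities

variable {ι κ : Type*} [Fintype ι] {G : MissingDAG ι κ} {η : ι → (ι → Bool) → ℝ≥0∞}

open Classical in
-- A member k of D without strict ancestors in D has a propensity that ignores the rest of D.
-- Summing over the rest first gives 1 by induction, and then the two values of r_k remain.
theorem sum_prod_propensity_eq_one
    (hloc : ∀ i r r', (∀ l, G.IndAnc l i → r l = r' l) → η i r = η i r')
    (hsum : ∀ i r, η i (Function.update r i true) + η i (Function.update r i false) = 1)
    (D : Finset ι) (hD : ∀ k ∈ D, ∀ l, G.IndAnc k l → l ∈ D) (r : ι → Bool) :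
    ∑ r' : ι → Bool with ∀ l, l ∉ D → r' l = r l, ∏ k ∈ D, η k r' = 1 := by
  induction hn : D.card generalizing D r with
  | zero =>
    obtain rfl := Finset.card_eq_zero.1 hn
    have : ({r' : ι → Bool | ∀ l, l ∉ (∅ : Finset ι) → r' l = r l} : Finset _) = {r} := by
      ext r'
      simp [funext_iff]
    rw [this]
    simp
  | succ n ih =>
    obtain ⟨k, hk, hmin⟩ := G.wellFounded_strictAnc.has_min (D : Set ι)
      (Finset.coe_nonempty.2 (Finset.card_pos.1 (by omega)))
    have hk : k ∈ D := hk
    have hD' : ∀ l ∈ D.erase k, ∀ m, G.IndAnc l m → m ∈ D.erase k := by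
      intro l hl m hlm
      rw [Finset.mem_erase] at hl ⊢
      refine ⟨?_, hD l hl.2 m hlm⟩
      rintro rfl
      exact hmin l hl.2 ⟨hlm, hl.1⟩
    have hfib (b : Bool) :
        ∑ r' ∈ ({r' : ι → Bool | ∀ l, l ∉ D → r' l = r l} : Finset _) with r' k = b,
          ∏ l ∈ D, η l r' = η k (Function.update r k b) := by
      rw [← mul_one (η k (Function.update r k b)),
        ← ih (D.erase k) hD' (Function.update r k b)
          (by rw [Finset.card_erase_of_mem hk]; omega), Finset.mul_sum]
      refine Finset.sum_congr ?_ fun r' hr' => ?_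
      · ext r'
        simp only [Finset.mem_filter, Finset.mem_univ, true_and, Finset.mem_erase]
        constructor
        · rintro ⟨h1, rfl⟩ l hl
          by_cases hlk : l = k
          · simp [hlk]
          · rw [Function.update_of_ne hlk]
            exact h1 l fun h => hl ⟨hlk, h⟩
        · intro h
          refine ⟨fun l hl => ?_, by simpa using h k⟩
          have hlk : l ≠ k := fun e => hl (e ▸ hk)
          simpa [hlk] using h l fun h => hl h.2
      · rw [← Finset.mul_prod_erase D (fun l => η l r') hk]
        congr 1
        refine hloc k _ _ fun l hl => ?_
        refine (Finset.mem_filter.1 hr').2 l fun h => ?_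
        exact hmin l (Finset.mem_of_mem_erase h) ⟨hl, Finset.ne_of_mem_erase h⟩
    rw [← Finset.sum_fiberwise _ fun r' : ι → Bool => r' k]
    simp_rw [hfib]
    rw [Fintype.sum_bool]
    exact hsum k r

open Classical in
-- The hypothesis `hpos` speaks only of patterns of nonzero density, and r need not be known to be
-- one. Going from ancestors to descendants, r is therefore altered on members of D that are not
-- strict ancestors of k to a pattern of nonzero density, which exists because the propensities sum
-- to 1.
theorem prod_propensity_ne_zero
    (hloc : ∀ i r r', (∀ l, G.IndAnc l i → r l = r' l) → η i r = η i r')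
    (hsum : ∀ i r, η i (Function.update r i true) + η i (Function.update r i false) = 1)
    {α : ℝ≥0∞}
    (hpos : ∀ r, α * ∏ i, η i r ≠ 0 → ∀ i, η i (Function.update r i true) ≠ 0)
    (D : Finset ι) (hD : ∀ k ∈ D, ∀ l, G.IndAnc k l → l ∈ D) (r : ι → Bool)
    (hr : ∀ k ∈ D, r k = true) (hα : α ≠ 0) (hne : ∀ l ∉ D, η l r ≠ 0) :
    ∀ k ∈ D, η k r ≠ 0 := by
  intro k
  induction k using G.wellFounded_strictAnc.induction with
  | _ k ih =>
    intro hk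
    set E : Finset ι := {l ∈ D | ¬ (G.IndAnc l k ∧ l ≠ k)} with hE
    have hEm (l : ι) : l ∈ E ↔ l ∈ D ∧ ¬ (G.IndAnc l k ∧ l ≠ k) := by simp [hE]
    have hEcl : ∀ l ∈ E, ∀ m, G.IndAnc l m → m ∈ E := by
      intro l hl m hlm
      rw [hEm] at hl ⊢
      refine ⟨hD l hl.1 m hlm, fun h => hl.2 ⟨hlm.trans h.1, ?_⟩⟩
      rintro rfl
      exact h.2 (h.1.antisymm hlm)
    have hoff : ∀ l ∉ E, η l r ≠ 0 := by
      intro l hl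
      by_cases hlD : l ∈ D
      · rw [hEm] at hl
        exact ih l (by tauto) hlD
      · exact hne l hlD
    obtain ⟨r', hr', hprod⟩ := Finset.exists_ne_zero_of_sum_ne_zero
      ((sum_prod_propensity_eq_one hloc hsum E hEcl r).trans_ne one_ne_zero)
    have hr' : ∀ l, l ∉ E → r' l = r l := (Finset.mem_filter.1 hr').2
    have h1 : α * ∏ i, η i r' ≠ 0 := by
      refine mul_ne_zero hα (Finset.prod_ne_zero_iff.2 fun l _ => ?_)
      by_cases hl : l ∈ E
      · exact Finset.prod_ne_zero_iff.1 hprod l hl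
      · rw [hloc l r' r fun m hm => hr' m fun h => hl (hEcl m h l hm)]
        exact hoff l hl
    -- Strict ancestors of k lie outside E, where r' = r, and r k = true; hence the propensity of k
    -- is the same at both patterns.
    rw [hloc k r (Function.update r' k true) fun l hl => ?_]
    · exact hpos r' h1 k
    · by_cases hlk : l = k
      · rw [hlk, Function.update_self, hr k hk]
      · rw [Function.update_of_ne hlk, hr' l fun h => ((hEm l).1 h).2 ⟨hl, hlk⟩]

end Propensities

/-! ### Locality of the conditional densities -/

section Local

variable {ι κ : Type*} {S : ι → Type*} {T : κ → Type*} {G : MissingDAG ι κ}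

theorem MissingDAG.IsLocalAt.eq_of_full {i : ι} {f : Config S T → ℝ≥0∞}
    (hf : G.IsLocalAt (.full i) f) (x : ∀ i, S i) (o : ∀ j, T j) (r r' : ι → Bool) :
    f (x, o, r) = f (x, o, r') := by
  refine hf _ _ rfl fun u hu => ?_
  cases u with
  | full k => rfl
  | obs k => rfl
  | ind k => exact absurd (.single hu) (G.de_ind_full k i)
  | proxy k =>
    exact absurd (.tail (.single ((G.pa_proxy k (.ind k)).2 (.inl rfl))) hu) (G.de_ind_full k i)

theorem MissingDAG.IsLocalAt.eq_of_obs {j : κ} {g : Config S T → ℝ≥0∞}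
    (hg : G.IsLocalAt (.obs j) g) (x : ∀ i, S i) (o : ∀ j, T j) (r r' : ι → Bool) :
    g (x, o, r) = g (x, o, r') := by
  refine hg _ _ rfl fun u hu => ?_
  cases u with
  | full k => rfl
  | obs k => rfl
  | ind k => exact absurd (.single hu) (G.de_ind_obs k j)
  | proxy k =>
    exact absurd (.tail (.single ((G.pa_proxy k (.ind k)).2 (.inl rfl))) hu) (G.de_ind_obs k j)

theorem MissingDAG.IsLocalAt.congr_ind {i : ι} {h : Config S T → ℝ≥0∞}
    (hh : G.IsLocalAt (.ind i) h) (x : ∀ i, S i) (o : ∀ j, T j) (r r' : ι → Bool)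
    (hr : ∀ l, G.IndAnc l i → r l = r' l) : h (x, o, r) = h (x, o, r') := by
  refine hh _ _ (hr i (.refl i)) fun u hu => ?_
  cases u with
  | full k => rfl
  | obs k => rfl
  | ind k => exact hr k (indAnc_of_edge hu)
  | proxy k => simp only [SameAt, proxyValue, hr k (indAnc_of_proxy_edge hu)]

/-- A parent X_k^(1) of R_i has R_k outside the ancestors of R_i, so r_k = 1 and the value is
observed. The case k = i cannot occur: R_i is its own ancestor, and its proxy is its child. -/
theorem MissingDAG.IsLocalAt.congr_full
    (hG : ∀ i j : ι, G.edge (.full j) (.ind i) → ¬ ReflTransGen G.edge (.ind j) (.ind i))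
    {i : ι} {h : Config S T → ℝ≥0∞}
    (hh : G.IsLocalAt (.ind i) h) (x x' : ∀ i, S i) (o : ∀ j, T j) (r : ι → Bool)
    (hr : ∀ j, ¬ G.IndAnc j i → r j = true) (hx : ∀ j, j ≠ i → r j = true → x j = x' j) :
    h (x, o, r) = h (x', o, r) := by
  refine hh _ _ rfl fun u hu => ?_
  cases u with
  | full k =>
    have hk := hG i k hu
    exact hx k (fun e => hk (e ▸ .refl)) (hr k hk)
  | obs k => rfl
  | ind k => rfl
  | proxy k =>
    simp only [SameAt, proxyValue]
    split_ifs with hk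
    · rw [hx k (ne_of_proxy_edge hu) hk]
    · rfl

end Local

/-! ### Factorization of the full law -/

section Factorization

variable {ι κ : Type*} {S : ι → Type*} {T : κ → Type*}
  [∀ i, MeasurableSpace (S i)] [∀ j, MeasurableSpace (T j)] [Fintype ι]

open Classical in
/-- A density `a(x^(1), o) ∏ h_i(x^(1), o, r)` of a full law `P` with respect to the product of
`ρ` and counting measure, where the `h_i` are positive conditional densities of the indicators that
depend on ancestors only and, when all the other indicators are 1, on observed values only. -/
structure Factorization (G : MissingDAG ι κ) (ρ : Measure ((∀ i, S i) × (∀ j, T j)))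
    (P : Measure (Config S T)) where
  a : (∀ i, S i) × (∀ j, T j) → ℝ≥0∞
  h : ι → (∀ i, S i) × (∀ j, T j) → (ι → Bool) → ℝ≥0∞
  measurable_a : Measurable a
  measurable_h : ∀ i r, Measurable fun z => h i z r
  congr_ind : ∀ i z r r', (∀ l, G.IndAnc l i → r l = r' l) → h i z r = h i z r'
  congr_full : ∀ i r z z', (∀ j, ¬ G.IndAnc j i → r j = true) → z.2 = z'.2 →
    (∀ j, j ≠ i → r j = true → z.1 j = z'.1 j) → h i z r = h i z' r
  sum_h : ∀ i z r, h i z (Function.update r i true) + h i z (Function.update r i false) = 1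
  lintegral_eq : ∀ F : Config S T → ℝ≥0∞, Measurable F →
    ∫⁻ c, F c ∂P = ∑ r : ι → Bool, ∫⁻ z, F (z.1, z.2, r) * (a z * ∏ i, h i z r) ∂ρ
  pos : ∀ᵐ z ∂ρ, ∀ r, a z * ∏ i, h i z r ≠ 0 → ∀ i, h i z (Function.update r i true) ≠ 0

open Classical in
theorem lintegral_prod_prod_count [Fintype κ] (μ : ∀ i, Measure (S i)) (ν : ∀ j, Measure (T j))
    [∀ i, SigmaFinite (μ i)] [∀ j, SigmaFinite (ν j)] {K : Config S T → ℝ≥0∞}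
    (hK : Measurable K) :
    ∫⁻ c, K c ∂((Measure.pi μ).prod ((Measure.pi ν).prod Measure.count)) =
      ∑ r : ι → Bool, ∫⁻ z : (∀ i, S i) × (∀ j, T j), K (z.1, z.2, r)
        ∂((Measure.pi μ).prod (Measure.pi ν)) := by
  have hKr (r : ι → Bool) :
      Measurable fun z : (∀ i, S i) × (∀ j, T j) => K (z.1, z.2, r) := by fun_prop
  rw [← lintegral_finsetSum _ fun r _ => hKr r, lintegral_prod _ hK.aemeasurable,
    lintegral_prod _ (Finset.measurable_fun_sum _ fun r _ => hKr r).aemeasurable]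
  refine lintegral_congr fun x => ?_
  rw [lintegral_prod _ (by fun_prop)]
  refine lintegral_congr fun o => ?_
  rw [lintegral_count, tsum_fintype]

variable [Fintype κ] {G : MissingDAG ι κ}

theorem MissingDAG.InModel.nonempty_factorization
    (hG : ∀ i j : ι, G.edge (.full j) (.ind i) → ¬ ReflTransGen G.edge (.ind j) (.ind i))
    {μ : ∀ i, Measure (S i)} {ν : ∀ j, Measure (T j)}
    [∀ i, SigmaFinite (μ i)] [∀ j, SigmaFinite (ν j)] {P : Measure (Config S T)}
    (hP : G.InModel μ ν P) :
    Nonempty (Factorization G ((Measure.pi μ).prod (Measure.pi ν)) P) := by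
  classical
  obtain ⟨-, f, g, h, hf, hg, hh, hPd, hpos⟩ := hP
  have hfm (i : ι) : Measurable (f i) := (hf i).1
  have hgm (j : κ) : Measurable (g j) := (hg j).1
  have hhm (i : ι) : Measurable (h i) := (hh i).1
  -- The factors of X^(1) and O do not depend on r, so the pattern inserted here is arbitrary.
  let a (z : (∀ i, S i) × (∀ j, T j)) : ℝ≥0∞ :=
    (∏ i, f i (z.1, z.2, fun _ => true)) * ∏ j, g j (z.1, z.2, fun _ => true)
  have ha : Measurable a := by fun_prop
  have hlint (F : Config S T → ℝ≥0∞) (hF : Measurable F) : ∫⁻ c, F c ∂P =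
      ∑ r : ι → Bool, ∫⁻ z, F (z.1, z.2, r) * (a z * ∏ i, h i (z.1, z.2, r))
        ∂((Measure.pi μ).prod (Measure.pi ν)) := by
    rw [hPd, lintegral_withDensity_eq_lintegral_mul _ (by fun_prop) hF,
      lintegral_prod_prod_count _ _ (by fun_prop)]
    refine Finset.sum_congr rfl fun r _ => lintegral_congr fun z => ?_
    simp only [Pi.mul_apply, a]
    rw [mul_comm]
    congr 3
    · exact Finset.prod_congr rfl fun i _ => (hf i).2.1.eq_of_full _ _ _ _
    · exact Finset.prod_congr rfl fun j _ => (hg j).2.1.eq_of_obs _ _ _ _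
  refine ⟨{
    a := a
    h := fun i z r => h i (z.1, z.2, r)
    measurable_a := ha
    measurable_h := fun i r => by fun_prop
    congr_ind := fun i z r r' hr => (hh i).2.1.congr_ind _ _ _ _ hr
    congr_full := ?_
    sum_h := ?_
    lintegral_eq := hlint
    pos := ?_ }⟩
  · rintro i r ⟨x, o⟩ ⟨x', o'⟩ hr ho hx
    obtain rfl : o = o' := ho
    exact (hh i).2.1.congr_full hG x x' o r hr hx
  · rintro i ⟨x, o⟩ r
    have := (hh i).2.2 (x, o, r)
    simp only [Config.setInd] at this
    convert this
  · rw [ae_all_iff]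
    intro r
    have hset (i : ι) : Measurable fun c : Config S T => h i (c.setInd i true) := by
      refine (hhm i).comp ?_
      simp only [Config.setInd]
      fun_prop
    have hN : MeasurableSet {c : Config S T | ∃ i, h i (c.setInd i true) = 0} := by
      have : {c : Config S T | ∃ i, h i (c.setInd i true) = 0} =
          ⋃ i, (fun c : Config S T => h i (c.setInd i true)) ⁻¹' {0} := by
        ext c
        simp
      rw [this]
      exact .iUnion fun i => hset i (measurableSet_singleton 0)
    have hN0 : P {c : Config S T | ∃ i, h i (c.setInd i true) = 0} = 0 := by
      have := ae_all_iff.2 hpos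
      rw [ae_iff] at this
      simpa using this
    -- The mass of the exceptional set is a sum over r of integrals, each of which vanishes; so the
    -- density at r is zero almost everywhere on it.
    rw [← lintegral_indicator_one hN, hlint _ (measurable_one.indicator hN),
      Finset.sum_eq_zero_iff] at hN0
    have h0 := hN0 r (Finset.mem_univ r)
    rw [lintegral_eq_zero_iff] at h0
    · filter_upwards [h0] with z hz hne i hi
      refine hne ?_
      rw [Set.indicator_of_mem] at hz
      · simpa using hz
      · refine ⟨i, ?_⟩
        simp only [Config.setInd]
        convert hi
    · have h1 : Measurable fun z : (∀ i, S i) × (∀ j, T j) => ((z.1, z.2, r) : Config S T) := by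
        fun_prop
      exact ((measurable_one.indicator hN).comp h1).mul (by fun_prop)

end Factorization

end MissingData

/-! ### Densities, inverse propensity weighting and the observed law -/

namespace MissingData

variable {ι κ : Type*} {S : ι → Type*} {T : κ → Type*}

/-- The function does not depend on `X_j^(1)` if `r_j = 0`. -/
def DependsOnObserved (r : ι → Bool) (φ : (∀ i, S i) × (∀ j, T j) → ℝ≥0∞) : Prop :=
  ∀ z z', z.2 = z'.2 → (∀ j, r j = true → z.1 j = z'.1 j) → φ z = φ z'

theorem DependsOnObserved.comp₂ {r : ι → Bool} {φ ψ : (∀ i, S i) × (∀ j, T j) → ℝ≥0∞}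
    (hφ : DependsOnObserved r φ) (hψ : DependsOnObserved r ψ) (b : ℝ≥0∞ → ℝ≥0∞ → ℝ≥0∞) :
    DependsOnObserved r fun z => b (φ z) (ψ z) := fun z z' h h' => by
  simp only [hφ z z' h h', hψ z z' h h']

theorem DependsOnObserved.mono {r r' : ι → Bool} {φ : (∀ i, S i) × (∀ j, T j) → ℝ≥0∞}
    (hφ : DependsOnObserved r φ) (hr : ∀ j, r j = true → r' j = true) :
    DependsOnObserved r' φ := fun z z' h h' => hφ z z' h fun j hj => h' j (hr j hj)

variable [∀ i, MeasurableSpace (S i)] [∀ j, MeasurableSpace (T j)] [Fintype ι]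
  {G : MissingDAG ι κ} {ρ : Measure ((∀ i, S i) × (∀ j, T j))} {P P' : Measure (Config S T)}

namespace Factorization

theorem h_le_one (A : Factorization G ρ P) (i : ι) (z : (∀ i, S i) × (∀ j, T j))
    (r : ι → Bool) : A.h i z r ≤ 1 := by
  classical
  rw [← A.sum_h i z r]
  cases hb : r i with
  | true =>
    refine le_trans (le_of_eq ?_) le_self_add
    rw [← hb, Function.update_eq_self]
  | false =>
    refine le_trans (le_of_eq ?_) le_add_self
    rw [← hb, Function.update_eq_self]

/-- The joint density of `X^(1), O, R`. -/
noncomputable def dens (A : Factorization G ρ P) (r : ι → Bool) (z : (∀ i, S i) × (∀ j, T j)) : ℝ≥0∞ :=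
  A.a z * ∏ i, A.h i z r

open Classical in
/-- The joint density of `X^(1), O` and the indicators that are not descendants of `R_i`. -/
noncomputable def predDens (A : Factorization G ρ P) (i : ι) (r : ι → Bool) (z : (∀ i, S i) × (∀ j, T j)) :
    ℝ≥0∞ :=
  A.a z * ∏ l with ¬ G.IndAnc i l, A.h l z r

open Classical in
/-- The product of the propensities of the strict descendants of `R_i`. -/
noncomputable def descProd (A : Factorization G ρ P) (i : ι) (r : ι → Bool) (z : (∀ i, S i) × (∀ j, T j)) :
    ℝ≥0∞ :=
  ∏ k with G.IndAnc i k ∧ k ≠ i, A.h k z r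

theorem dens_eq (A : Factorization G ρ P) (i : ι) (r : ι → Bool)
    (z : (∀ i, S i) × (∀ j, T j)) :
    A.dens r z = A.predDens i r z * A.h i z r * A.descProd i r z := by
  classical
  have h : ({l | G.IndAnc i l} : Finset ι) = insert i ({k | G.IndAnc i k ∧ k ≠ i} : Finset ι) := by
    ext l
    by_cases hl : l = i <;> simp [hl, MissingDAG.IndAnc.refl]
  rw [dens, predDens, descProd,
    ← Finset.prod_filter_mul_prod_filter_not Finset.univ (fun l => G.IndAnc i l), h,
    Finset.prod_insert (by simp)]
  ring

theorem measurable_dens (A : Factorization G ρ P) (r : ι → Bool) : Measurable (A.dens r) :=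
  A.measurable_a.mul (Finset.measurable_fun_prod _ fun i _ => A.measurable_h i r)

theorem measurable_predDens (A : Factorization G ρ P) (i : ι) (r : ι → Bool) :
    Measurable (A.predDens i r) :=
  A.measurable_a.mul (Finset.measurable_fun_prod _ fun i _ => A.measurable_h i r)

theorem measurable_descProd (A : Factorization G ρ P) (i : ι) (r : ι → Bool) :
    Measurable (A.descProd i r) :=
  Finset.measurable_fun_prod _ fun i _ => A.measurable_h i r

theorem descProd_ne_top (A : Factorization G ρ P) (i : ι) (r : ι → Bool)
    (z : (∀ i, S i) × (∀ j, T j)) : A.descProd i r z ≠ ∞ :=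
  ENNReal.prod_ne_top fun k _ => ((A.h_le_one k z r).trans_lt ENNReal.one_lt_top).ne

theorem predDens_le (A : Factorization G ρ P) (i : ι) (r : ι → Bool)
    (z : (∀ i, S i) × (∀ j, T j)) : A.predDens i r z ≤ A.a z :=
  mul_le_of_le_one_right' (Finset.prod_le_one' fun l _ => A.h_le_one l z r)

open Classical in
theorem predDens_update (A : Factorization G ρ P) (i : ι) (r : ι → Bool) (b : Bool)
    (z : (∀ i, S i) × (∀ j, T j)) :
    A.predDens i (Function.update r i b) z = A.predDens i r z := by
  refine congrArg _ (Finset.prod_congr rfl fun l hl => A.congr_ind l z _ _ fun m hm => ?_)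
  rw [Function.update_of_ne]
  rintro rfl
  exact (Finset.mem_filter.1 hl).2 hm

open Classical in
theorem sum_dens (A : Factorization G ρ P) (z : (∀ i, S i) × (∀ j, T j)) :
    ∑ r, A.dens r z = A.a z := by
  have := sum_prod_propensity_eq_one (η := fun i r => A.h i z r)
    (fun i r r' h => A.congr_ind i z r r' h) (fun i r => A.sum_h i z r) Finset.univ
    (fun _ _ _ _ => Finset.mem_univ _) (fun _ => true)
  simp only [Finset.mem_univ, not_true_eq_false, false_imp_iff, implies_true,
    Finset.filter_true] at this
  simp only [dens, ← Finset.mul_sum, this, mul_one]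

theorem targetLaw_eq (A : Factorization G ρ P) : targetLaw P = ρ.withDensity A.a := by
  classical
  refine Measure.ext_of_lintegral _ fun F hF => ?_
  rw [targetLaw, lintegral_map hF (by fun_prop), A.lintegral_eq _ (by fun_prop),
    lintegral_withDensity_eq_lintegral_mul _ A.measurable_a hF]
  refine (lintegral_finsetSum _ fun r _ => hF.mul (A.measurable_dens r)).symm.trans ?_
  refine lintegral_congr fun z => ?_
  rw [Pi.mul_apply, ← A.sum_dens z, mul_comm, Finset.mul_sum]
  simp only [Pi.mul_apply]

theorem lintegral_a [IsProbabilityMeasure P] (A : Factorization G ρ P) :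
    ∫⁻ z, A.a z ∂ρ = 1 := by
  rw [← setLIntegral_univ, ← withDensity_apply _ .univ, ← A.targetLaw_eq, targetLaw,
    Measure.map_apply (by fun_prop) .univ, Set.preimage_univ, measure_univ]

theorem predDens_lintegral_ne_top [IsProbabilityMeasure P] (A : Factorization G ρ P) (i : ι)
    (r : ι → Bool) : ∫⁻ z, A.predDens i r z ∂ρ ≠ ∞ :=
  ((lintegral_mono (A.predDens_le i r)).trans_lt (A.lintegral_a ▸ ENNReal.one_lt_top)).ne

open Classical in
theorem ae_h_ne_zero (A : Factorization G ρ P) (D : Finset ι)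
    (hD : ∀ k ∈ D, ∀ l, G.IndAnc k l → l ∈ D) (r : ι → Bool) (hr : ∀ k ∈ D, r k = true) :
    ∀ᵐ z ∂ρ, A.a z ≠ 0 → (∀ l ∉ D, A.h l z r ≠ 0) → ∀ k ∈ D, A.h k z r ≠ 0 := by
  filter_upwards [A.pos] with z hz ha hne
  exact prod_propensity_ne_zero (η := fun i r => A.h i z r)
    (fun i r r' h => A.congr_ind i z r r' h) (fun i r => A.sum_h i z r) hz D hD r hr ha hne

theorem ae_descProd_ne_zero (A : Factorization G ρ P) (i : ι) (r : ι → Bool)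
    (hr : ∀ k, G.IndAnc i k → k ≠ i → r k = true) :
    ∀ᵐ z ∂ρ, A.predDens i r z * A.h i z r ≠ 0 → A.descProd i r z ≠ 0 := by
  classical
  have h := A.ae_h_ne_zero ({k | G.IndAnc i k ∧ k ≠ i} : Finset ι)
    (fun k hk l hl => by
      simp only [Finset.mem_filter, Finset.mem_univ, true_and] at hk ⊢
      refine ⟨hk.1.trans hl, ?_⟩
      rintro rfl
      exact hk.2 (hl.antisymm hk.1)) r
    (fun k hk => by
      simp only [Finset.mem_filter, Finset.mem_univ, true_and] at hk
      exact hr k hk.1 hk.2)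
  filter_upwards [h] with z hz hne
  obtain ⟨h1, h2⟩ := mul_ne_zero_iff.1 hne
  obtain ⟨h3, h4⟩ := mul_ne_zero_iff.1 h1
  refine Finset.prod_ne_zero_iff.2 (hz h3 fun l hl => ?_)
  by_cases hli : l = i
  · exact hli ▸ h2
  · refine Finset.prod_ne_zero_iff.1 h4 l ?_
    simp only [Finset.mem_filter, Finset.mem_univ, true_and] at hl ⊢
    tauto

theorem predDens_ne_zero (A : Factorization G ρ P) {r : ι → Bool}
    {z : (∀ i, S i) × (∀ j, T j)} (h : A.dens r z ≠ 0) (i : ι) : A.predDens i r z ≠ 0 := by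
  rw [A.dens_eq i] at h
  exact left_ne_zero_of_mul (left_ne_zero_of_mul h)

open Classical in
-- Observed values are taken with r_i = 0 because h_i never involves x_i^(1); this makes h_i an
-- admissible factor of test functions for both values of r_i.
theorem dependsOnObserved_h (A : Factorization G ρ P) (i : ι) (r : ι → Bool)
    (hr : ∀ j, ¬ G.IndAnc j i → r j = true) (b : Bool) :
    DependsOnObserved (Function.update r i false) fun z => A.h i z (Function.update r i b) := by
  intro z z' hz hx
  refine A.congr_full i _ z z' (fun j hj => ?_) hz fun j hj hj' => ?_
  · rw [Function.update_of_ne, hr j hj]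
    rintro rfl
    exact hj (.refl _)
  · rw [Function.update_of_ne hj] at hj'
    exact hx j (by rw [Function.update_of_ne hj, hj'])

theorem dependsOnObserved_descProd (A : Factorization G ρ P) (i : ι) (r : ι → Bool)
    (hr : ∀ j, ¬ G.IndAnc j i → r j = true) : DependsOnObserved r (A.descProd i r) := by
  intro z z' hz hx
  classical
  refine Finset.prod_congr rfl fun k hk => A.congr_full k r z z' (fun j hj => ?_) hz
    fun j _ hj => hx j hj
  exact hr j fun h => hj (h.trans (Finset.mem_filter.1 hk).2.1)

/-- The observed law determines the integrals against the joint density of the functions of the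
observed variables. -/
theorem lintegral_mul_dens (A : Factorization G ρ P) (x₀ : ∀ i, S i) (r : ι → Bool)
    {φ : (∀ i, S i) × (∀ j, T j) → ℝ≥0∞} (hφ : Measurable φ) (hd : DependsOnObserved r φ) :
    ∫⁻ z, φ z * A.dens r z ∂ρ =
      ∫⁻ y, ({y | y.1 = r} : Set ((ι → Bool) × (∀ j, T j) × (∀ i, S i ⊕ Unit))).indicator
        (fun y => φ (fun i => Sum.elim id (fun _ => x₀ i) (y.2.2 i), y.2.1)) y
        ∂(observedLaw P) := by
  classical
  have hs : MeasurableSet {y : (ι → Bool) × (∀ j, T j) × (∀ i, S i ⊕ Unit) | y.1 = r} :=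
    measurable_fst (measurableSet_singleton r)
  have hfill : Measurable fun y : (ι → Bool) × (∀ j, T j) × (∀ i, S i ⊕ Unit) =>
      φ (fun i => Sum.elim id (fun _ => x₀ i) (y.2.2 i), y.2.1) := by
    refine hφ.comp (Measurable.prodMk (measurable_pi_lambda _ fun i => ?_) (by fun_prop))
    exact (measurable_id.sumElim measurable_const).comp
      (show Measurable fun y : (ι → Bool) × (∀ j, T j) × (∀ i, S i ⊕ Unit) => y.2.2 i by fun_prop)
  rw [observedLaw, lintegral_map (hfill.indicator hs) measurable_observe,
    A.lintegral_eq _ (by exact (hfill.indicator hs).comp measurable_observe),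
    Finset.sum_eq_single r]
  · refine lintegral_congr fun z => ?_
    rw [Set.indicator_of_mem (by rfl), dens]
    congr 1
    refine hd _ _ rfl fun j hj => ?_
    simp [observe, proxyValue, hj]
  · intro r' _ hr'
    rw [lintegral_eq_zero_of_ae_eq_zero]
    refine .of_forall fun z => ?_
    dsimp only
    rw [Set.indicator_of_notMem (by exact hr'), zero_mul]
    rfl
  · exact fun h => absurd (Finset.mem_univ r) h

theorem lintegral_mul_dens_congr [IsProbabilityMeasure P] (A : Factorization G ρ P)
    (B : Factorization G ρ P') (hobs : observedLaw P = observedLaw P') (r : ι → Bool)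
    {φ : (∀ i, S i) × (∀ j, T j) → ℝ≥0∞} (hφ : Measurable φ) (hd : DependsOnObserved r φ) :
    ∫⁻ z, φ z * A.dens r z ∂ρ = ∫⁻ z, φ z * B.dens r z ∂ρ := by
  obtain ⟨c⟩ := nonempty_of_isProbabilityMeasure P
  rw [A.lintegral_mul_dens c.1 r hφ hd, B.lintegral_mul_dens c.1 r hφ hd, hobs]

theorem lintegral_inv_descProd_mul_dens (A : Factorization G ρ P) (i : ι) (r : ι → Bool)
    (hr : ∀ k, G.IndAnc i k → k ≠ i → r k = true) (ψ : (∀ i, S i) × (∀ j, T j) → ℝ≥0∞) :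
    ∫⁻ z, ψ z * (A.descProd i r z)⁻¹ * A.dens r z ∂ρ =
      ∫⁻ z, ψ z * (A.predDens i r z * A.h i z r) ∂ρ := by
  refine lintegral_congr_ae ?_
  filter_upwards [A.ae_descProd_ne_zero i r hr] with z hz
  rw [A.dens_eq i]
  by_cases h : A.predDens i r z * A.h i z r = 0
  -- The inverse may be ∞ here, but the density vanishes and ∞ · 0 = 0.
  · simp [h]
  · rw [mul_comm (A.predDens i r z * _), mul_assoc, ← mul_assoc _⁻¹,
      ENNReal.inv_mul_cancel (hz h) (A.descProd_ne_top i r z), one_mul]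

/-- The weight of A is a function of the observed values, so it may be integrated against either
law; `hB` then replaces it by the weight of B where that density is nonzero. -/
theorem lintegral_mul_predDens_mul_h_congr [IsProbabilityMeasure P] (A : Factorization G ρ P)
    (B : Factorization G ρ P') (hobs : observedLaw P = observedLaw P') (i : ι) (r : ι → Bool)
    (hr : ∀ j, ¬ G.IndAnc j i → r j = true)
    (hB : ∀ᵐ z ∂ρ, B.dens r z ≠ 0 → A.descProd i r z = B.descProd i r z)
    {ψ : (∀ i, S i) × (∀ j, T j) → ℝ≥0∞} (hψ : Measurable ψ) (hd : DependsOnObserved r ψ) :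
    ∫⁻ z, ψ z * (A.predDens i r z * A.h i z r) ∂ρ =
      ∫⁻ z, ψ z * (B.predDens i r z * B.h i z r) ∂ρ := by
  have hr' (k : ι) (hk : G.IndAnc i k) (hne : k ≠ i) : r k = true :=
    hr k fun h => hne (h.antisymm hk)
  rw [← A.lintegral_inv_descProd_mul_dens i r hr', ← B.lintegral_inv_descProd_mul_dens i r hr',
    A.lintegral_mul_dens_congr B hobs r (by exact hψ.mul (A.measurable_descProd i r).inv)
      (hd.comp₂ (A.dependsOnObserved_descProd i r hr) fun x y => x * y⁻¹)]
  refine lintegral_congr_ae ?_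
  filter_upwards [hB] with z hz
  by_cases h : B.dens r z = 0
  · simp [h]
  · rw [hz h]

end Factorization

end MissingData

/-! ### Identification of the propensities and of the target law -/

namespace MissingData

/-- On {v < u} one has w v ≤ w u with equal finite integrals, hence equality almost everywhere,
which forces w = 0 there. -/
theorem ae_le_of_lintegral_indicator_eq {Ω : Type*} [MeasurableSpace Ω] {ρ : Measure Ω}
    {u v w : Ω → ℝ≥0∞} (hu : Measurable u) (hv : Measurable v) (hw : Measurable w)
    (hv1 : ∀ z, v z ≤ 1) (hwi : ∫⁻ z, w z ∂ρ ≠ ∞)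
    (h : ∫⁻ z, (if v z < u z then 1 else 0) * (w z * u z) ∂ρ =
      ∫⁻ z, (if v z < u z then 1 else 0) * (w z * v z) ∂ρ) :
    ∀ᵐ z ∂ρ, w z ≠ 0 → u z ≤ v z := by
  have hind : Measurable fun z => if v z < u z then (1 : ℝ≥0∞) else 0 :=
    Measurable.ite (measurableSet_lt hv hu) measurable_const measurable_const
  have hfin : ∫⁻ z, (if v z < u z then 1 else 0) * (w z * v z) ∂ρ ≠ ∞ := by
    refine ((lintegral_mono fun z => ?_).trans_lt (lt_top_iff_ne_top.2 hwi)).ne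
    refine mul_le_of_le_one_of_le ?_ (mul_le_of_le_one_right' (hv1 z))
    split_ifs <;> simp
  have hae := ae_eq_of_ae_le_of_lintegral_le (μ := ρ)
    (f := fun z => (if v z < u z then 1 else 0) * (w z * v z))
    (g := fun z => (if v z < u z then 1 else 0) * (w z * u z))
    (.of_forall fun z => by
      simp only
      split_ifs with hz
      · gcongr
      · simp) hfin (hind.mul (hw.mul hu)).aemeasurable h.le
  filter_upwards [hae, ae_lt_top hw hwi] with z hz hwz hw0
  by_contra! hlt
  simp only [if_pos hlt, one_mul] at hz
  exact hlt.ne ((ENNReal.mul_right_inj hw0 hwz.ne).1 hz)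

namespace Factorization

variable {ι κ : Type*} {S : ι → Type*} {T : κ → Type*}
  [∀ i, MeasurableSpace (S i)] [∀ j, MeasurableSpace (T j)] [Fintype ι]
  {G : MissingDAG ι κ} {ρ : Measure ((∀ i, S i) × (∀ j, T j))} {P P' : Measure (Config S T)}

/-- The inductive step of the identification of the propensities: if the propensities of the strict
descendants of `R_i` are identified, so is the propensity of `R_i`. -/
theorem ae_h_eq_of_strictDesc [IsProbabilityMeasure P] (A : Factorization G ρ P)
    (B : Factorization G ρ P') (hobs : observedLaw P = observedLaw P') (i : ι)
    (ih : ∀ k, G.IndAnc i k → k ≠ i → ∀ r : ι → Bool, (∀ j, ¬ G.IndAnc j k → r j = true) →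
      ∀ᵐ z ∂ρ, B.predDens k r z ≠ 0 → A.h k z r = B.h k z r)
    (r : ι → Bool) (hr : ∀ j, ¬ G.IndAnc j i → r j = true) :
    ∀ᵐ z ∂ρ, A.predDens i r z ≠ 0 → A.h i z r = B.h i z r := by
  classical
  have hrb (b : Bool) (j : ι) (hj : ¬ G.IndAnc j i) : Function.update r i b j = true := by
    rw [Function.update_of_ne, hr j hj]
    rintro rfl
    exact hj (.refl _)
  have hB (b : Bool) : ∀ᵐ z ∂ρ, B.dens (Function.update r i b) z ≠ 0 →
      A.descProd i (Function.update r i b) z = B.descProd i (Function.update r i b) z := by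
    have : ∀ᵐ z ∂ρ, ∀ k, G.IndAnc i k → k ≠ i → B.predDens k (Function.update r i b) z ≠ 0 →
        A.h k z (Function.update r i b) = B.h k z (Function.update r i b) := by
      refine ae_all_iff.2 fun k => ?_
      by_cases hk : G.IndAnc i k ∧ k ≠ i
      · filter_upwards [ih k hk.1 hk.2 _ fun j hj => hrb b j fun h => hj (h.trans hk.1)]
          with z hz _ _ using hz
      · exact .of_forall fun z h1 h2 => absurd ⟨h1, h2⟩ hk
    filter_upwards [this] with z hz hne
    refine Finset.prod_congr rfl fun k hk => ?_
    obtain ⟨-, h1, h2⟩ := Finset.mem_filter.1 hk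
    exact hz k h1 h2 (B.predDens_ne_zero hne k)
  have hkey (b : Bool) (ψ : (∀ i, S i) × (∀ j, T j) → ℝ≥0∞) (hψ : Measurable ψ)
      (hd : DependsOnObserved (Function.update r i false) ψ) :
      ∫⁻ z, ψ z * (A.predDens i r z * A.h i z (Function.update r i b)) ∂ρ =
        ∫⁻ z, ψ z * (B.predDens i r z * B.h i z (Function.update r i b)) ∂ρ := by
    have hd' : DependsOnObserved (Function.update r i b) ψ := by
      refine hd.mono fun j hj => ?_
      by_cases hji : j = i
      · simp [hji] at hj
      · rw [Function.update_of_ne hji] at hj ⊢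
        exact hj
    have := A.lintegral_mul_predDens_mul_h_congr B hobs i _ (hrb b) (hB b) hψ hd'
    simpa only [predDens_update] using this
  have hsplit {Q : Measure (Config S T)} (C : Factorization G ρ Q)
      (ψ : (∀ i, S i) × (∀ j, T j) → ℝ≥0∞) (hψ : Measurable ψ) :
      ∫⁻ z, ψ z * C.predDens i r z ∂ρ =
        ∫⁻ z, ψ z * (C.predDens i r z * C.h i z (Function.update r i true)) ∂ρ +
        ∫⁻ z, ψ z * (C.predDens i r z * C.h i z (Function.update r i false)) ∂ρ := by
    rw [← lintegral_add_left
      (by exact hψ.mul ((C.measurable_predDens i r).mul (C.measurable_h i _)))]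
    refine lintegral_congr fun z => ?_
    rw [← mul_add, ← mul_add, C.sum_h, mul_one]
  -- Adding the identities for r_i = 1 and r_i = 0 removes h_i; ψ must be admissible for both, hence
  -- may not use x_i^(1).
  have hw (ψ : (∀ i, S i) × (∀ j, T j) → ℝ≥0∞) (hψ : Measurable ψ)
      (hd : DependsOnObserved (Function.update r i false) ψ) :
      ∫⁻ z, ψ z * A.predDens i r z ∂ρ = ∫⁻ z, ψ z * B.predDens i r z ∂ρ := by
    rw [hsplit A ψ hψ, hsplit B ψ hψ, hkey true ψ hψ hd, hkey false ψ hψ hd]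
  have hdA := A.dependsOnObserved_h i r hr (r i)
  have hdB := B.dependsOnObserved_h i r hr (r i)
  rw [Function.update_eq_self] at hdA hdB
  -- Pass from A to B by `hkey`, then exchange only q_i back by `hw` with the test function ψ h_i of
  -- B: both propensities now face the same weight.
  have heq (ψ : (∀ i, S i) × (∀ j, T j) → ℝ≥0∞) (hψ : Measurable ψ)
      (hd : DependsOnObserved (Function.update r i false) ψ) :
      ∫⁻ z, ψ z * (A.predDens i r z * A.h i z r) ∂ρ =
        ∫⁻ z, ψ z * (A.predDens i r z * B.h i z r) ∂ρ := by
    have h1 := hkey (r i) ψ hψ hd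
    have h2 := hw (fun z => ψ z * B.h i z r) (hψ.mul (B.measurable_h i r))
      (hd.comp₂ hdB fun x y => x * y)
    rw [Function.update_eq_self] at h1
    rw [h1]
    simp only [mul_assoc, mul_comm (B.h i _ r)] at h2
    exact h2.symm
  have hmA := A.measurable_h i r
  have hmB := B.measurable_h i r
  have hmw := A.measurable_predDens i r
  have hfin := A.predDens_lintegral_ne_top i r
  have hle := ae_le_of_lintegral_indicator_eq hmA hmB hmw (fun z => B.h_le_one i z r) hfin
    (heq _ (Measurable.ite (measurableSet_lt hmB hmA) measurable_const measurable_const)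
      (hdA.comp₂ hdB fun x y => if y < x then 1 else 0))
  have hge := ae_le_of_lintegral_indicator_eq hmB hmA hmw (fun z => A.h_le_one i z r) hfin
    (heq _ (Measurable.ite (measurableSet_lt hmA hmB) measurable_const measurable_const)
      (hdA.comp₂ hdB fun x y => if x < y then 1 else 0)).symm
  filter_upwards [hle, hge] with z h1 h2 h0
  exact le_antisymm (h1 h0) (h2 h0)

/-- The disjunction makes the claim symmetric in the two laws, so the inductive step can be applied
in both directions. -/
theorem ae_h_eq [IsProbabilityMeasure P] [IsProbabilityMeasure P'] (A : Factorization G ρ P)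
    (B : Factorization G ρ P') (hobs : observedLaw P = observedLaw P') (i : ι) (r : ι → Bool)
    (hr : ∀ j, ¬ G.IndAnc j i → r j = true) :
    ∀ᵐ z ∂ρ, A.predDens i r z ≠ 0 ∨ B.predDens i r z ≠ 0 → A.h i z r = B.h i z r := by
  induction i using G.wellFounded_strictDesc.induction generalizing r with
  | _ i ih =>
    have hA := A.ae_h_eq_of_strictDesc B hobs i (fun k h1 h2 r hr => by
      filter_upwards [ih k ⟨h1, h2⟩ r hr] with z hz hne using hz (.inr hne)) r hr
    have hB := B.ae_h_eq_of_strictDesc A hobs.symm i (fun k h1 h2 r hr => by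
      filter_upwards [ih k ⟨h1, h2⟩ r hr] with z hz hne using (hz (.inl hne)).symm) r hr
    filter_upwards [hA, hB] with z h1 h2 hne
    exact hne.elim h1 fun h => (h2 h).symm

/-- In the complete cases everything is observed, so every indicator function is an admissible test
function. -/
theorem ae_dens_eq [IsProbabilityMeasure P] (A : Factorization G ρ P)
    (B : Factorization G ρ P') (hobs : observedLaw P = observedLaw P') :
    A.dens (fun _ => true) =ᵐ[ρ] B.dens fun _ => true := by
  have hφ (s : Set ((∀ i, S i) × (∀ j, T j))) (hs : MeasurableSet s) :
      ∫⁻ z in s, A.dens (fun _ => true) z ∂ρ = ∫⁻ z in s, B.dens (fun _ => true) z ∂ρ := by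
    have := A.lintegral_mul_dens_congr B hobs (fun _ => true)
      (φ := s.indicator 1) (measurable_one.indicator hs) fun z z' h h' => by
        rw [Prod.ext (funext fun j => h' j rfl) h]
    simp only [← Set.indicator_mul_left, Pi.one_apply, one_mul] at this
    rwa [← lintegral_indicator hs, ← lintegral_indicator hs]
  have hfin : ∫⁻ z, A.dens (fun _ => true) z ∂ρ ≠ ∞ := by
    refine ((lintegral_mono fun z => ?_).trans_lt (A.lintegral_a ▸ ENNReal.one_lt_top)).ne
    exact mul_le_of_le_one_right' (Finset.prod_le_one' fun l _ => A.h_le_one l z _)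
  refine (A.measurable_dens _).aemeasurable.ae_eq_of_forall_setLIntegral_eq
    (B.measurable_dens _).aemeasurable hfin ?_ fun s hs _ => hφ s hs
  rwa [← setLIntegral_univ, ← hφ _ .univ, setLIntegral_univ]

theorem ae_a_eq [IsProbabilityMeasure P] [IsProbabilityMeasure P'] (A : Factorization G ρ P)
    (B : Factorization G ρ P') (hobs : observedLaw P = observedLaw P') :
    A.a =ᵐ[ρ] B.a := by
  have hh := ae_all_iff.2 fun i => A.ae_h_eq B hobs i (fun _ => true) fun _ _ => rfl
  have hA := A.ae_h_ne_zero Finset.univ (fun _ _ _ _ => Finset.mem_univ _) (fun _ => true)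
    fun _ _ => rfl
  have hB := B.ae_h_ne_zero Finset.univ (fun _ _ _ _ => Finset.mem_univ _) (fun _ => true)
    fun _ _ => rfl
  filter_upwards [hh, hA, hB, A.ae_dens_eq B hobs] with z hh hA hB hd
  -- Wherever a ≠ 0 complete cases have nonzero density, so no part of the target law is lost.
  have hA' : A.a z ≠ 0 → A.dens (fun _ => true) z ≠ 0 := fun h => mul_ne_zero h
    (Finset.prod_ne_zero_iff.2 (hA h fun l hl => absurd (Finset.mem_univ l) hl))
  have hB' : B.a z ≠ 0 → B.dens (fun _ => true) z ≠ 0 := fun h => mul_ne_zero h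
    (Finset.prod_ne_zero_iff.2 (hB h fun l hl => absurd (Finset.mem_univ l) hl))
  by_cases h : A.dens (fun _ => true) z = 0
  · have h' : B.dens (fun _ => true) z = 0 := hd ▸ h
    rw [not_imp_not.1 hA' h, not_imp_not.1 hB' h']
  · have hprod : ∏ i, A.h i z (fun _ => true) = ∏ i, B.h i z (fun _ => true) :=
      Finset.prod_congr rfl fun i _ => hh i (.inl (A.predDens_ne_zero h i))
    have hne : ∏ i, A.h i z (fun _ => true) ≠ 0 := right_ne_zero_of_mul h
    have htop : ∏ i, A.h i z (fun _ => true) ≠ ∞ :=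
      ENNReal.prod_ne_top fun i _ => ((A.h_le_one i z _).trans_lt ENNReal.one_lt_top).ne
    simp only [dens, ← hprod] at hd
    exact (ENNReal.mul_left_inj hne htop).1 hd

end Factorization

theorem MissingDAG.targetIdentified {ι κ : Type*} [Fintype ι] [Fintype κ] {G : MissingDAG ι κ}
    (hG : ∀ i j : ι, G.edge (.full j) (.ind i) → ¬ ReflTransGen G.edge (.ind j) (.ind i))
    {S : ι → Type*} {T : κ → Type*}
    [∀ i, MeasurableSpace (S i)] [∀ j, MeasurableSpace (T j)]
    (μ : ∀ i, Measure (S i)) (ν : ∀ j, Measure (T j))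
    [∀ i, SigmaFinite (μ i)] [∀ j, SigmaFinite (ν j)] :
    G.TargetIdentified μ ν := by
  classical
  -- Any law of the model with observed law Q may serve, since the target law is the same for all of
  -- them; the value 0 outside the model is arbitrary.
  refine ⟨fun Q => if h : ∃ P, G.InModel μ ν P ∧ observedLaw P = Q then targetLaw h.choose else 0,
    fun P hP => ?_⟩
  have hex : ∃ P', G.InModel μ ν P' ∧ observedLaw P' = observedLaw P := ⟨P, hP, rfl⟩
  obtain ⟨hP', hobs⟩ := hex.choose_spec
  dsimp only
  rw [dif_pos hex]
  have := hP.1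
  have := hP'.1
  obtain ⟨A⟩ := hP.nonempty_factorization hG
  obtain ⟨B⟩ := hP'.nonempty_factorization hG
  rw [A.targetLaw_eq, B.targetLaw_eq]
  exact withDensity_congr_ae (A.ae_a_eq B hobs.symm)

end MissingData

theorem mainTheorem5 {ι κ : Type*} [Fintype ι] [Fintype κ] (G : MissingData.MissingDAG ι κ)
    (hG : ∀ i j : ι, G.edge (.full j) (.ind i) → ¬ ReflTransGen G.edge (.ind j) (.ind i)) :
    (∀ i : ι, G.Valid (G.ancestralSchedule i) (fun _ => MissingData.allFull ι κ)) ∧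
    ∀ {S : ι → Type*} {T : κ → Type*}
      [∀ i, MeasurableSpace (S i)] [∀ j, MeasurableSpace (T j)]
      (μ : ∀ i, Measure (S i)) (ν : ∀ j, Measure (T j))
      [∀ i, SigmaFinite (μ i)] [∀ j, SigmaFinite (ν j)],
      G.TargetIdentified μ ν :=
  ⟨MissingData.MissingDAG.valid_ancestralSchedule hG,
    fun μ ν => MissingData.MissingDAG.targetIdentified hG μ ν⟩
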